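/- Let $G=(V,E)$ be a connected simple graph, finite or infinite, that is $d$-regular with $1\le d<\infty$, and let $\mathrm{dist}$ be its combinatorial distance. Put $S_k(x)=\{z\in V:\mathrm{dist}(x,z)=k\}$. *Ollivier curvature.* For $p\in[0,1]$ let $\mu_x^p$ be the probability distribution on $V$ with $\mu_x^p(x)=p$, $\mu_x^p(z)=\frac{1-p}{d}$ if $z\sim x$, and $\mu_x^p(z)=0$ otherwise. Let $W_1(\mu_1,\mu_2)=\inf_\pi\sum_{u,v\in V}\mathrm{dist}(u,v)\,\pi(u,v)$, the infimum being over all $\pi:V\times V\to[0,\infty)$ with $\sum_v\pi(u,v)=\mu_1(u)$ for all $u$ and $\sum_u\pi(u,v)=\mu_2(v)$ for all $v$. For an edge $\{x,y\}$ put $\kappa_p(x,y)=1-W_1(\mu_x^p,\mu_y^p)$ and $\kappa_{LLY}(x,y)=\lim_{p\to1^-}\frac{\kappa_p(x,y)}{1-p}$. *Bakry–Émery curvature.* For $f,g:V\to\mathbb R$ put $\Delta f(x)=\sum_{y\sim x}(f(y)-f(x))$, $2\Gamma(f,g)=\Delta(fg)-f\Delta g-g\Delta f$ and $2\Gamma_2(f,g)=\Delta\Gamma(f,g)-\Gamma(f,\Delta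 g)-\Gamma(\Delta f,g)$. For $N\in(0,\infty)$ let $\mathcal K(x,N)$ be the largest $K\in\mathbb R$ such that $\Gamma_2(f,f)(x)\ge\frac1N(\Delta f(x))^2+K\,\Gamma(f,f)(x)$ for all $f:V\to\mathbb R$, and put $\mathcal K_\infty(x)=\lim_{N\to\infty}\mathcal K(x,N)$. **Theorem.** Let $x\in V$ be a vertex that is contained in no triangle, and suppose that every $z\in S_2(x)$ has at most $2$ neighbours in $S_1(x)$. (a) If $\kappa_0(x,y)=0$ for all $y\in S_1(x)$, then $\mathcal K_\infty(x)\ge 0$. (b) If $\kappa_{LLY}(x,y)=\frac2d$ for all $y\in S_1(x)$, then $\mathcal K_\infty(x)=2$. -/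

import Mathlib

open Filter Topology

namespace GraphCurvature

noncomputable section

universe u

variable {V : Type u} (G : SimpleGraph V)

/-- The sphere `S_k(x)` of radius `k` for the combinatorial distance. -/
def sphere (x : V) (k : ℕ) : Set V := {z | G.dist x z = k}

/-- The in-degree `d_x^-(z)`: the number of neighbours of `z` that are one step closer to `x`
than `z` is. For `z ∈ S_2(x)` these are the neighbours of `z` in `S_1(x)`. -/
def inDegree (x z : V) : ℕ := {w | G.Adj z w ∧ G.dist x w + 1 = G.dist x z}.ncard

/-- The vertex `x` lies on no triangle of `G`. -/
def NotInTriangle (x : V) : Prop := ∀ y z : V, G.Adj x y → G.Adj x z → ¬ G.Adj y z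

/-! ### Ollivier Ricci curvature -/

open Classical in
/-- The distribution `μ_x^p`: mass `p` at `x` and mass `(1 - p) / d_x` at each neighbour. -/
def lazyMeasure [G.LocallyFinite] (p : ℝ) (x z : V) : ℝ :=
  if z = x then p else if G.Adj x z then (1 - p) / (G.degree x : ℝ) else 0

/-- `π` is a transport plan from `μ₁` to `μ₂`. -/
structure IsTransportPlan {V : Type u} (μ₁ μ₂ : V → ℝ) (π : V → V → ℝ) : Prop where
  nonneg : ∀ u v, 0 ≤ π u v
  fst_marginal : ∀ u, HasSum (fun v => π u v) (μ₁ u)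
  snd_marginal : ∀ v, HasSum (fun u => π u v) (μ₂ v)

/-- The Wasserstein distance `W₁`: the infimum of the costs `∑ d(u,v) π(u,v)` of the transport
plans (of finite cost). For finitely supported `μ₁`, `μ₂` all these sums are finite sums. -/
def wasserstein (μ₁ μ₂ : V → ℝ) : ℝ :=
  sInf {c : ℝ | ∃ π : V → V → ℝ, IsTransportPlan μ₁ μ₂ π ∧
    HasSum (fun q : V × V => (G.dist q.1 q.2 : ℝ) * π q.1 q.2) c}

/-- The `p`-Ollivier Ricci curvature `κ_p(x,y) = 1 - W₁(μ_x^p, μ_y^p)`. -/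
def ollivierCurvature [G.LocallyFinite] (p : ℝ) (x y : V) : ℝ :=
  1 - wasserstein G (lazyMeasure G p x) (lazyMeasure G p y)

/-- `κ_LLY(x,y) = κ`, that is, `κ_p(x,y) / (1 - p)` tends to `κ` as `p → 1` from below. -/
def HasLLYCurvature [G.LocallyFinite] (x y : V) (κ : ℝ) : Prop :=
  Tendsto (fun p : ℝ => ollivierCurvature G p x y / (1 - p)) (𝓝[<] 1) (𝓝 κ)

/-! ### Bakry-Émery curvature -/

/-- The non-normalized Laplacian `Δ f (x) = ∑_{y ∼ x} (f y - f x)`. -/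
def laplacian [G.LocallyFinite] (f : V → ℝ) (x : V) : ℝ :=
  ∑ y ∈ G.neighborFinset x, (f y - f x)

/-- `2 Γ(f,g) = Δ(fg) - f Δ g - g Δ f`. -/
def gam [G.LocallyFinite] (f g : V → ℝ) (x : V) : ℝ :=
  (laplacian G (fun v => f v * g v) x - f x * laplacian G g x - g x * laplacian G f x) / 2

/-- `2 Γ₂(f,g) = Δ Γ(f,g) - Γ(f, Δ g) - Γ(Δ f, g)`. -/
def gamTwo [G.LocallyFinite] (f g : V → ℝ) (x : V) : ℝ :=
  (laplacian G (gam G f g) x - gam G f (laplacian G g) x - gam G (laplacian G f) g x) / 2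

/-- The curvature-dimension inequality `CD(K, N)` at the vertex `x` (finite `N > 0`). -/
def CDAt [G.LocallyFinite] (x : V) (K N : ℝ) : Prop :=
  ∀ f : V → ℝ, (1 / N) * (laplacian G f x) ^ 2 + K * gam G f f x ≤ gamTwo G f f x

/-- `𝒦(x, N) = K`, that is, `K` is the largest real number such that `x` satisfies `CD(K, N)`. -/
def HasBECurvature [G.LocallyFinite] (x : V) (N K : ℝ) : Prop :=
  IsGreatest {K' : ℝ | CDAt G x K' N} K

/-- `𝒦_∞(x) = K`, that is, `𝒦(x, N)` exists for every `N > 0` and tends to `K` as `N → ∞`. -/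
def HasBECurvatureInfty [G.LocallyFinite] (x : V) (K : ℝ) : Prop :=
  ∃ κ : ℝ → ℝ, (∀ N : ℝ, 0 < N → HasBECurvature G x N (κ N)) ∧ Tendsto κ atTop (𝓝 K)

/-- The value `𝒦_∞(x)` is unique. -/
theorem HasBECurvatureInfty.unique [G.LocallyFinite] {x : V} {K L : ℝ}
    (hK : HasBECurvatureInfty G x K) (hL : HasBECurvatureInfty G x L) : K = L := by
  obtain ⟨κ, hκ, hκK⟩ := hK
  obtain ⟨l, hl, hlL⟩ := hL
  refine tendsto_nhds_unique (hκK.congr' ?_) hlL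
  filter_upwards [eventually_gt_atTop 0] with N hN
  exact (hκ N hN).unique (hl N hN)

end

end GraphCurvature

namespace GraphCurvature

open Finset

/-! Completing squares turns 4Γ₂(f,f)(x) into a sum of squares (f z - 2 f y + f x)² over paths x ~ y
~ z with z ≠ x, plus (4 - 2d) Σ (f y - f x)² + 2 (Δf x)². If y, u ∈ S₁(x) share a neighbour z ≠ x,
the two squares at z dominate 2 (f y - f u)²; in-degree at most two means that z serves no other
pair (`sum_matched_le`). Summed over all ordered pairs, Σ (f y - f u)² = 2d Σ (f y - f x)² - 2 (Δf
x)², which would leave exactly 8Γ. Missing pairs, at most k per neighbour, cost at most 8kΓ, so Γ₂ ≥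
(2 - 2k) Γ (`mul_gam_le_gamTwo`).

Ollivier curvature bounds k by weak Kantorovich duality: κ₀ = 0 forces k ≤ 1
(`card_unmatched_le_one`), and κ_LLY = 2/d forces k = 0 (`not_unmatched_of_hasLLYCurvature`). The
distance from x as test function gives the upper bound in (b). -/

section BakryEmery

variable {V : Type*} {G : SimpleGraph V}

/-- Two neighbours `y`, `u` of `x` that have no common neighbour besides `x`. -/
def Unmatched (G : SimpleGraph V) (x y u : V) : Prop :=
  u ≠ y ∧ ∀ z, G.Adj y z → G.Adj u z → z = x

theorem Unmatched.symm {x y u : V} (h : Unmatched G x y u) : Unmatched G x u y :=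
  ⟨h.1.symm, fun z hu hy => h.2 z hy hu⟩

/-- If `x` lies on no triangle, the neighbours other than `x` of a neighbour of `x` are at
distance two. -/
theorem dist_eq_two {x y z : V} (htri : NotInTriangle G x) (hxy : G.Adj x y) (hyz : G.Adj y z)
    (hz : z ≠ x) : G.dist x z = 2 := by
  have hle : G.dist x z ≤ 2 := SimpleGraph.dist_le (.cons hxy (.cons hyz .nil))
  have hr : G.Reachable x z := hxy.reachable.trans hyz.reachable
  have h0 : G.dist x z ≠ 0 := fun h => hz (hr.dist_eq_zero_iff.1 h).symm
  have h1 : G.dist x z ≠ 1 := fun h => htri y z hxy (SimpleGraph.dist_eq_one_iff_adj.1 h) hyz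
  omega

variable [G.LocallyFinite]

/-! ### The Bakry–Émery side -/

theorem gam_eq_sum (f g : V → ℝ) (x : V) :
    gam G f g x = (∑ y ∈ G.neighborFinset x, (f y - f x) * (g y - g x)) / 2 := by
  simp only [gam, laplacian, mul_sum, ← sum_sub_distrib]
  congr 1
  exact sum_congr rfl fun y _ => by ring

theorem gam_comm (f g : V → ℝ) (x : V) : gam G f g x = gam G g f x := by
  simp only [gam_eq_sum, mul_comm]

theorem gam_self (f : V → ℝ) (x : V) :
    gam G f f x = (∑ y ∈ G.neighborFinset x, (f y - f x) ^ 2) / 2 := by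
  simp only [gam_eq_sum, sq]

theorem sq_laplacian_le (f : V → ℝ) (x : V) :
    laplacian G f x ^ 2 ≤ 2 * (G.degree x : ℝ) * gam G f f x := by
  have h := sq_sum_le_card_mul_sum_sq (s := G.neighborFinset x) (f := fun y => f y - f x)
  rw [G.card_neighborFinset_eq_degree] at h
  rw [gam_self]
  unfold laplacian
  linarith

/-- The quadratic form `4 Γ₂` at a vertex of a regular graph, with the contributions of the
second neighbours completed to squares. -/
theorem four_mul_gamTwo [DecidableEq V] {d : ℕ} (hreg : G.IsRegularOfDegree d) (f : V → ℝ)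
    (x : V) :
    4 * gamTwo G f f x =
      ∑ y ∈ G.neighborFinset x, ∑ z ∈ (G.neighborFinset y).erase x, (f z - 2 * f y + f x) ^ 2
        + (4 - 2 * d) * ∑ y ∈ G.neighborFinset x, (f y - f x) ^ 2
        + 2 * laplacian G f x ^ 2 := by
  -- Write f z - 2 f y + f x = (f z - f y) - (f y - f x) and sum over all z ~ y; the term z = x,
  -- equal to 4 (f y - f x)², is then removed.
  have hinner : ∀ y ∈ G.neighborFinset x,
      ∑ z ∈ (G.neighborFinset y).erase x, (f z - 2 * f y + f x) ^ 2 =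
        2 * gam G f f y - 2 * (f y - f x) * laplacian G f y + (d - 4) * (f y - f x) ^ 2 := by
    intro y hy
    have hx : x ∈ G.neighborFinset y := by
      rw [SimpleGraph.mem_neighborFinset] at hy ⊢
      exact hy.symm
    have hcard : ((G.neighborFinset y).card : ℝ) = d := by
      rw [G.card_neighborFinset_eq_degree, hreg y]
    have h := add_sum_erase (G.neighborFinset y) (fun z => (f z - 2 * f y + f x) ^ 2) hx
    have hexp : ∑ z ∈ G.neighborFinset y, (f z - 2 * f y + f x) ^ 2 =
        2 * gam G f f y - 2 * (f y - f x) * laplacian G f y + d * (f y - f x) ^ 2 := by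
      have hpt : ∀ z ∈ G.neighborFinset y, (f z - 2 * f y + f x) ^ 2 =
          (f z - f y) ^ 2 - 2 * (f y - f x) * (f z - f y) + (f y - f x) ^ 2 :=
        fun z _ => by ring
      rw [sum_congr rfl hpt, sum_add_distrib, sum_sub_distrib, ← mul_sum, sum_const, nsmul_eq_mul,
        hcard, gam_self]
      unfold laplacian
      ring
    rw [hexp] at h
    linear_combination h
  have hcard : ((G.neighborFinset x).card : ℝ) = d := by
    rw [G.card_neighborFinset_eq_degree, hreg x]
  rw [sum_congr rfl hinner, gamTwo, gam_comm (laplacian G f) f, gam_eq_sum f (laplacian G f)]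
  have h1 : laplacian G (gam G f f) x =
      ∑ y ∈ G.neighborFinset x, gam G f f y - d * gam G f f x := by
    rw [laplacian, sum_sub_distrib, sum_const, nsmul_eq_mul, hcard]
  have h2 : ∑ y ∈ G.neighborFinset x, (f y - f x) * (laplacian G f y - laplacian G f x) =
      ∑ y ∈ G.neighborFinset x, (f y - f x) * laplacian G f y - laplacian G f x ^ 2 := by
    simp only [mul_sub, sum_sub_distrib, ← sum_mul, laplacian]
    ring
  rw [h1, h2, gam_self f x, sum_add_distrib, sum_sub_distrib, ← mul_sum, ← mul_sum]
  simp only [mul_assoc, ← mul_sum]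
  ring

/-- A vertex of in-degree at most two has at most one neighbour in the first sphere besides a
given one. -/
theorem eq_of_inDegree_le_two {x y u v z : V} (htri : NotInTriangle G x)
    (hin : ∀ z ∈ sphere G x 2, inDegree G x z ≤ 2) (hz : z ≠ x)
    (hxy : G.Adj x y) (hxu : G.Adj x u) (hxv : G.Adj x v)
    (hyz : G.Adj y z) (huz : G.Adj u z) (hvz : G.Adj v z) (huy : u ≠ y) (hvy : v ≠ y) :
    u = v := by
  by_contra huv
  have hd : G.dist x z = 2 := dist_eq_two htri hxy hyz hz
  -- `Set.ncard` is zero on infinite sets, so comparing cardinalities needs finiteness.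
  have hfin : {w | G.Adj z w ∧ G.dist x w + 1 = G.dist x z}.Finite :=
    (G.neighborFinset z).finite_toSet.subset fun w hw => by
      simpa using hw.1
  have hsub : ({y, u, v} : Set V) ⊆ {w | G.Adj z w ∧ G.dist x w + 1 = G.dist x z} := by
    rintro w (rfl | rfl | rfl)
    · exact ⟨hyz.symm, by rw [hd, SimpleGraph.dist_eq_one_iff_adj.2 hxy]⟩
    · exact ⟨huz.symm, by rw [hd, SimpleGraph.dist_eq_one_iff_adj.2 hxu]⟩
    · exact ⟨hvz.symm, by rw [hd, SimpleGraph.dist_eq_one_iff_adj.2 hxv]⟩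
  have hcard : ({y, u, v} : Set V).ncard = 3 :=
    Set.ncard_eq_three.2 ⟨y, u, v, huy.symm, hvy.symm, huv, rfl⟩
  have h3 := Set.ncard_le_ncard hsub hfin
  have h2 := hin z hd
  unfold inDegree at h2
  omega

open Classical in
/-- The contribution of the second neighbours to `4 Γ₂` dominates the sum of the squared
differences of `f` over the matched pairs of neighbours. -/
theorem sum_matched_le {x : V} (htri : NotInTriangle G x)
    (hin : ∀ z ∈ sphere G x 2, inDegree G x z ≤ 2) (f : V → ℝ) :
    ∑ y ∈ G.neighborFinset x, ∑ u ∈ G.neighborFinset x,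
        (if Unmatched G x y u then 0 else (f y - f u) ^ 2) ≤
      ∑ y ∈ G.neighborFinset x, ∑ z ∈ (G.neighborFinset y).erase x,
        (f z - 2 * f y + f x) ^ 2 := by
  set S := G.neighborFinset x with hS
  set F : V → V → ℝ := fun y z => (f z - 2 * f y + f x) ^ 2
  -- The common neighbours of y and u other than x, empty for u = y. The symmetry of `T` allows the
  -- two squares at z to be exchanged.
  set T : V → V → Finset V := fun y u => {z ∈ (G.neighborFinset y).erase x | u ≠ y ∧ G.Adj u z}
    with hT
  have hTsymm : ∀ y u, T y u = T u y := by
    intro y u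
    ext z
    simp only [hT, mem_filter, mem_erase, SimpleGraph.mem_neighborFinset]
    tauto
  -- For fixed y and z at most one u qualifies, so no square is counted twice.
  have hle : ∑ y ∈ S, ∑ u ∈ S, ∑ z ∈ T y u, F y z ≤
      ∑ y ∈ S, ∑ z ∈ (G.neighborFinset y).erase x, F y z := by
    refine sum_le_sum fun y hy => ?_
    have hcomm : ∑ u ∈ S, ∑ z ∈ T y u, F y z =
        ∑ z ∈ (G.neighborFinset y).erase x, ∑ u ∈ S with u ≠ y ∧ G.Adj u z, F y z :=
      sum_comm' fun u z => by simp only [hT, mem_filter]; tauto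
    rw [hcomm]
    refine sum_le_sum fun z hz => ?_
    rw [sum_const, nsmul_eq_mul]
    refine mul_le_of_le_one_left (sq_nonneg _) ?_
    rw [Nat.cast_le_one, card_le_one]
    simp only [hS, mem_erase, mem_filter, SimpleGraph.mem_neighborFinset] at hy hz ⊢
    rintro u ⟨hu, huy, huz⟩ v ⟨hv, hvy, hvz⟩
    exact eq_of_inDegree_le_two htri hin hz.1 hy hu hv hz.2 huz hvz huy hvy
  have hswap : ∑ y ∈ S, ∑ u ∈ S, ∑ z ∈ T y u, F y z = ∑ y ∈ S, ∑ u ∈ S, ∑ z ∈ T y u, F u z := by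
    rw [sum_comm]
    exact sum_congr rfl fun y _ => sum_congr rfl fun u _ => by rw [hTsymm]
  have hpt : ∑ y ∈ S, ∑ u ∈ S, 2 * (if Unmatched G x y u then 0 else (f y - f u) ^ 2) ≤
      ∑ y ∈ S, ∑ u ∈ S, ∑ z ∈ T y u, (F y z + F u z) := by
    refine sum_le_sum fun y _ => sum_le_sum fun u _ => ?_
    have hnonneg : ∀ z ∈ T y u, 0 ≤ F y z + F u z := fun z _ => by positivity
    split_ifs with hum
    · simpa using sum_nonneg hnonneg
    · by_cases huy : u = y
      · simpa [huy] using sum_nonneg hnonneg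
      · obtain ⟨z, hyz, huz, hzx⟩ : ∃ z, G.Adj y z ∧ G.Adj u z ∧ z ≠ x := by
          by_contra! h
          exact hum ⟨huy, h⟩
        have hz : z ∈ T y u := by simp [hT, hyz, huz, hzx, huy]
        refine le_trans ?_ (single_le_sum hnonneg hz)
        simp only [F]
        -- Parallelogram law: the two squares add up to 2 (f y - f u)² + 2 (f z - f y - f u + f x)².
        nlinarith [sq_nonneg (f z - f y - f u + f x)]
  simp only [sum_add_distrib, ← mul_sum] at hpt
  rw [← hswap] at hpt
  linarith

theorem sum_sum_sub_sq {ι : Type*} (S : Finset ι) (g : ι → ℝ) :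
    ∑ i ∈ S, ∑ j ∈ S, (g i - g j) ^ 2 = 2 * #S * ∑ i ∈ S, g i ^ 2 - 2 * (∑ i ∈ S, g i) ^ 2 := by
  simp only [sub_sq, sum_add_distrib, sum_sub_distrib, ← mul_sum, ← sum_mul, sum_const,
    nsmul_eq_mul]
  ring

open Classical in
/-- If every neighbour of `x` is unmatched with at most `k` others, then `x` satisfies the
curvature-dimension inequality `CD(2 - 2k, ∞)`. -/
theorem mul_gam_le_gamTwo {d : ℕ} (hreg : G.IsRegularOfDegree d) {x : V}
    (htri : NotInTriangle G x) (hin : ∀ z ∈ sphere G x 2, inDegree G x z ≤ 2) {k : ℕ}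
    (hk : ∀ y ∈ G.neighborFinset x, #{u ∈ G.neighborFinset x | Unmatched G x y u} ≤ k)
    (f : V → ℝ) : (2 - 2 * k) * gam G f f x ≤ gamTwo G f f x := by
  have hfour := four_mul_gamTwo hreg f x
  have hmatched := sum_matched_le htri hin f
  set S := G.neighborFinset x with hS
  have hcard : (#S : ℝ) = d := by rw [hS, G.card_neighborFinset_eq_degree, hreg x]
  have hpairs : ∑ y ∈ S, ∑ u ∈ S, (f y - f u) ^ 2 =
      2 * d * ∑ y ∈ S, (f y - f x) ^ 2 - 2 * laplacian G f x ^ 2 := by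
    have h := sum_sum_sub_sq S fun y => f y - f x
    simp only [sub_sub_sub_cancel_right, hcard] at h
    exact h
  have hsplit : ∑ y ∈ S, ∑ u ∈ S, (f y - f u) ^ 2 =
      ∑ y ∈ S, ∑ u ∈ S, (if Unmatched G x y u then 0 else (f y - f u) ^ 2) +
        ∑ y ∈ S, ∑ u ∈ S, (if Unmatched G x y u then (f y - f u) ^ 2 else 0) := by
    simp only [← sum_add_distrib]
    refine sum_congr rfl fun y _ => sum_congr rfl fun u _ => ?_
    split_ifs <;> simp
  have hbound : ∑ y ∈ S, ∑ u ∈ S, (if Unmatched G x y u then (f y - f u) ^ 2 else 0) ≤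
      4 * k * ∑ y ∈ S, (f y - f x) ^ 2 := by
    have hswap : ∑ y ∈ S, ∑ u ∈ S, (if Unmatched G x y u then (f u - f x) ^ 2 else 0) =
        ∑ y ∈ S, ∑ u ∈ S, (if Unmatched G x y u then (f y - f x) ^ 2 else 0) := by
      rw [sum_comm]
      refine sum_congr rfl fun y _ => sum_congr rfl fun u _ => ?_
      simp only [show Unmatched G x u y ↔ Unmatched G x y u from ⟨.symm, .symm⟩]
    have hdeg : ∑ y ∈ S, ∑ u ∈ S, (if Unmatched G x y u then (f y - f x) ^ 2 else 0) ≤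
        k * ∑ y ∈ S, (f y - f x) ^ 2 := by
      rw [mul_sum]
      refine sum_le_sum fun y hy => ?_
      rw [← sum_filter, sum_const, nsmul_eq_mul]
      exact mul_le_mul_of_nonneg_right (by exact_mod_cast hk y hy) (sq_nonneg _)
    have hpt : ∑ y ∈ S, ∑ u ∈ S, (if Unmatched G x y u then (f y - f u) ^ 2 else 0) ≤
        ∑ y ∈ S, ∑ u ∈ S, (2 * (if Unmatched G x y u then (f y - f x) ^ 2 else 0) +
          2 * (if Unmatched G x y u then (f u - f x) ^ 2 else 0)) := by
      refine sum_le_sum fun y _ => sum_le_sum fun u _ => ?_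
      split_ifs
      · nlinarith [sq_nonneg (f y - f x + (f u - f x))]
      · simp
    simp only [sum_add_distrib, ← mul_sum] at hpt
    linarith
  rw [gam_self]
  linarith

/-! ### Finite dimension and the limit N → ∞ -/

/-- By Cauchy–Schwarz (Δf)² ≤ 2dΓ, so the dimension term costs at most 2d/N of curvature. -/
theorem cdAt_sub_div {d : ℕ} (hreg : G.IsRegularOfDegree d) {x : V} {K N : ℝ} (hN : 0 < N)
    (h : ∀ f : V → ℝ, K * gam G f f x ≤ gamTwo G f f x) : CDAt G x (K - 2 * d / N) N := by
  intro f
  have h1 := sq_laplacian_le (G := G) f x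
  rw [hreg x] at h1
  have h2 := mul_le_mul_of_nonneg_left h1 (by positivity : 0 ≤ 1 / N)
  have h3 := h f
  have h4 : 1 / N * (2 * d * gam G f f x) = 2 * d / N * gam G f f x := by ring
  linarith

/-- The distance function from `x` shows that the curvature of dimension `N` is at most
`2 - 2d/N` at a vertex on no triangle. -/
theorem CDAt.le {d : ℕ} (hd : 0 < d) (hreg : G.IsRegularOfDegree d) {x : V}
    (htri : NotInTriangle G x) {K N : ℝ} (h : CDAt G x K N) : K ≤ 2 - 2 * d / N := by
  classical
  set f : V → ℝ := fun v => G.dist x v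
  have hx : f x = 0 := by simp [f]
  have hone : ∀ y ∈ G.neighborFinset x, f y = 1 := fun y hy => by
    simpa [f] using hy
  have hlap : laplacian G f x = d := by
    rw [laplacian, sum_congr rfl fun y hy => by rw [hone y hy, hx]]
    simp [hreg x]
  have hsq : ∑ y ∈ G.neighborFinset x, (f y - f x) ^ 2 = d := by
    rw [sum_congr rfl fun y hy => by rw [hone y hy, hx]]
    simp [hreg x]
  have hzero : ∑ y ∈ G.neighborFinset x, ∑ z ∈ (G.neighborFinset y).erase x,
      (f z - 2 * f y + f x) ^ 2 = 0 := by
    refine sum_eq_zero fun y hy => sum_eq_zero fun z hz => ?_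
    rw [hone y hy, hx]
    simp only [mem_erase, SimpleGraph.mem_neighborFinset] at hy hz
    simp [f, dist_eq_two htri hy hz.2 hz.1]
  have hfour := four_mul_gamTwo hreg f x
  have hf := h f
  rw [hzero, hsq, hlap] at hfour
  rw [gam_self, hsq, hlap] at hf
  have hd' : (0 : ℝ) < d := by exact_mod_cast hd
  have h2 : 1 / N * (d : ℝ) ^ 2 = d * (2 * d / N) / 2 := by ring
  have h3 : d * (K - (2 - 2 * d / N)) ≤ 0 := by nlinarith
  have h4 := nonpos_of_mul_nonpos_right h3 hd'
  linarith

theorem CDAt.mono {x : V} {K N M : ℝ} (hN : 0 < N) (hNM : N ≤ M) (h : CDAt G x K N) :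
    CDAt G x K M := fun f =>
  le_trans (by gcongr) (h f)

/-- Each f imposes a closed condition, affine in K. Closedness makes the supremum attained, so that
𝒦(x, N) exists. -/
theorem isClosed_setOf_cdAt (x : V) (N : ℝ) : IsClosed {K | CDAt G x K N} := by
  simp only [CDAt, Set.ofPred_forall]
  exact isClosed_iInter fun f => isClosed_le (by fun_prop) continuous_const

/-- If every neighbour of `x` is matched with all the others, then `𝒦(x, N) = 2 - 2d/N`. -/
theorem hasBECurvatureInfty_two {d : ℕ} (hd : 0 < d) (hreg : G.IsRegularOfDegree d) {x : V}
    (htri : NotInTriangle G x) (h : ∀ f : V → ℝ, 2 * gam G f f x ≤ gamTwo G f f x) :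
    HasBECurvatureInfty G x 2 := by
  refine ⟨fun N => 2 - 2 * d / N, fun N hN =>
    ⟨cdAt_sub_div hreg hN h, fun K hK => CDAt.le hd hreg htri hK⟩, ?_⟩
  simpa using (tendsto_const_nhds (x := (2 : ℝ))).sub
    (tendsto_const_nhds (x := (2 * d : ℝ)).div_atTop tendsto_id)

/-- `CD(K, ∞)` implies that `𝒦_∞(x)` exists and is at least `K`. -/
theorem exists_hasBECurvatureInfty {d : ℕ} (hd : 0 < d) (hreg : G.IsRegularOfDegree d) {x : V}
    (htri : NotInTriangle G x) {K : ℝ} (h : ∀ f : V → ℝ, K * gam G f f x ≤ gamTwo G f f x) :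
    ∃ L : ℝ, HasBECurvatureInfty G x L ∧ K ≤ L := by
  set κ : ℝ → ℝ := fun N => sSup {K' | CDAt G x K' N}
  have hbdd : ∀ N, BddAbove {K' | CDAt G x K' N} := fun N =>
    ⟨2 - 2 * d / N, fun K' hK' => CDAt.le hd hreg htri hK'⟩
  have hκ : ∀ N, 0 < N → HasBECurvature G x N (κ N) := fun N hN =>
    (isClosed_setOf_cdAt x N).isGreatest_csSup ⟨_, cdAt_sub_div hreg hN h⟩ (hbdd N)
  -- Monotonicity in N holds only for N > 0; truncating at 1 gives a function monotone on all of ℝ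
  -- with the same limit.
  have hpos : ∀ N : ℝ, 0 < max N 1 := fun N => by positivity
  have hmono : Monotone fun N => κ (max N 1) := fun N M hNM =>
    (hκ _ (hpos M)).2 ((hκ _ (hpos N)).1.mono (hpos N) (max_le_max_right 1 hNM))
  have hbound : BddAbove (Set.range fun N => κ (max N 1)) := by
    refine ⟨2, ?_⟩
    rintro _ ⟨N, rfl⟩
    have h1 := CDAt.le hd hreg htri (hκ _ (hpos N)).1
    have h2 : 0 ≤ 2 * (d : ℝ) / max N 1 := by positivity
    linarith
  have hlim : Tendsto κ atTop (𝓝 (⨆ N, κ (max N 1))) := by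
    refine (tendsto_atTop_ciSup hmono hbound).congr' ?_
    filter_upwards [eventually_ge_atTop 1] with N hN
    rw [max_eq_left hN]
  refine ⟨_, ⟨κ, hκ, hlim⟩, ?_⟩
  have hlow : Tendsto (fun N : ℝ => K - 2 * d / N) atTop (𝓝 K) := by
    simpa using (tendsto_const_nhds (x := K)).sub
      (tendsto_const_nhds (x := (2 * d : ℝ)).div_atTop tendsto_id)
  refine le_of_tendsto_of_tendsto hlow hlim ?_
  filter_upwards [eventually_gt_atTop 0] with N hN
  exact (hκ N hN).2 (cdAt_sub_div hreg hN h)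

end BakryEmery

section Ollivier

/-! ### The Ollivier side -/

/-! ### Transport plans and weak duality -/

section Transport

variable {V : Type*} {G : SimpleGraph V} {μ₁ μ₂ : V → ℝ} {π : V → V → ℝ} {A B : Finset V}

theorem IsTransportPlan.eq_zero_left (hπ : IsTransportPlan μ₁ μ₂ π) {u : V} (hu : μ₁ u = 0)
    (v : V) : π u v = 0 := by
  have h := hπ.fst_marginal u
  rw [hu, hasSum_zero_iff_of_nonneg (hπ.nonneg u)] at h
  exact congrFun h v

theorem IsTransportPlan.eq_zero_right (hπ : IsTransportPlan μ₁ μ₂ π) {v : V} (hv : μ₂ v = 0)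
    (u : V) : π u v = 0 := by
  have h := hπ.snd_marginal v
  rw [hv, hasSum_zero_iff_of_nonneg fun u => hπ.nonneg u v] at h
  exact congrFun h u

theorem IsTransportPlan.sum_right (hπ : IsTransportPlan μ₁ μ₂ π) (hB : ∀ v ∉ B, μ₂ v = 0)
    (u : V) : ∑ v ∈ B, π u v = μ₁ u :=
  (hasSum_sum_of_ne_finset_zero fun v hv => hπ.eq_zero_right (hB v hv) u).unique
    (hπ.fst_marginal u)

theorem IsTransportPlan.sum_left (hπ : IsTransportPlan μ₁ μ₂ π) (hA : ∀ u ∉ A, μ₁ u = 0)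
    (v : V) : ∑ u ∈ A, π u v = μ₂ v :=
  (hasSum_sum_of_ne_finset_zero fun u hu => hπ.eq_zero_left (hA u hu) v).unique
    (hπ.snd_marginal v)

theorem isTransportPlan_mul (h₁ : ∀ u, 0 ≤ μ₁ u) (h₂ : ∀ v, 0 ≤ μ₂ v)
    (hs₁ : HasSum μ₁ 1) (hs₂ : HasSum μ₂ 1) :
    IsTransportPlan μ₁ μ₂ fun u v => μ₁ u * μ₂ v where
  nonneg u v := mul_nonneg (h₁ u) (h₂ v)
  fst_marginal u := by simpa using hs₂.mul_left (μ₁ u)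
  snd_marginal v := by simpa using hs₁.mul_right (μ₂ v)

/-- Weak Kantorovich duality for finitely supported probability distributions. -/
theorem sub_le_wasserstein (hA : ∀ u ∉ A, μ₁ u = 0) (hB : ∀ v ∉ B, μ₂ v = 0)
    (h₁ : ∀ u, 0 ≤ μ₁ u) (h₂ : ∀ v, 0 ≤ μ₂ v)
    (hs₁ : ∑ u ∈ A, μ₁ u = 1) (hs₂ : ∑ v ∈ B, μ₂ v = 1) (φ ψ : V → ℝ)
    (hφψ : ∀ u ∈ A, ∀ v ∈ B, φ u - ψ v ≤ G.dist u v) :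
    ∑ u ∈ A, φ u * μ₁ u - ∑ v ∈ B, ψ v * μ₂ v ≤ wasserstein G μ₁ μ₂ := by
  have hcost : ∀ π : V → V → ℝ, IsTransportPlan μ₁ μ₂ π →
      HasSum (fun q : V × V => (G.dist q.1 q.2 : ℝ) * π q.1 q.2)
        (∑ q ∈ A ×ˢ B, (G.dist q.1 q.2 : ℝ) * π q.1 q.2) := by
    intro π hπ
    refine hasSum_sum_of_ne_finset_zero fun q hq => ?_
    rw [mem_product, not_and_or] at hq
    rcases hq with hq | hq
    · rw [hπ.eq_zero_left (hA _ hq), mul_zero]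
    · rw [hπ.eq_zero_right (hB _ hq), mul_zero]
  refine le_csInf ?_ ?_
  -- The product plan shows that the infimum is not over the empty set.
  · have hπ := isTransportPlan_mul h₁ h₂ (hs₁ ▸ hasSum_sum_of_ne_finset_zero hA)
      (hs₂ ▸ hasSum_sum_of_ne_finset_zero hB)
    exact ⟨_, _, hπ, hcost _ hπ⟩
  · rintro c ⟨π, hπ, hc⟩
    rw [hc.unique (hcost π hπ), sum_product]
    calc ∑ u ∈ A, φ u * μ₁ u - ∑ v ∈ B, ψ v * μ₂ v
        = ∑ u ∈ A, ∑ v ∈ B, φ u * π u v - ∑ v ∈ B, ∑ u ∈ A, ψ v * π u v := by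
          simp only [← mul_sum, hπ.sum_right hB, hπ.sum_left hA]
      _ = ∑ u ∈ A, ∑ v ∈ B, (φ u - ψ v) * π u v := by
          rw [sum_comm (s := B)]
          simp only [sub_mul, sum_sub_distrib]
      _ ≤ _ := sum_le_sum fun u hu => sum_le_sum fun v hv =>
          mul_le_mul_of_nonneg_right (hφψ u hu v hv) (hπ.nonneg u v)

end Transport

variable {V : Type*} {G : SimpleGraph V}

theorem one_le_dist (hconn : G.Connected) {u v : V} (h : u ≠ v) : (1 : ℝ) ≤ G.dist u v := by
  exact_mod_cast hconn.pos_dist_of_ne h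

theorem two_le_dist (hconn : G.Connected) {u v : V} (h : u ≠ v) (hadj : ¬ G.Adj u v) :
    (2 : ℝ) ≤ G.dist u v := by
  have h0 := hconn.pos_dist_of_ne h
  have h1 : G.dist u v ≠ 1 := fun h => hadj (SimpleGraph.dist_eq_one_iff_adj.1 h)
  exact_mod_cast (by omega : 2 ≤ G.dist u v)

variable [G.LocallyFinite]

theorem lazyMeasure_self (p : ℝ) (x : V) : lazyMeasure G p x x = p := by
  simp [lazyMeasure]

theorem lazyMeasure_of_adj {p : ℝ} {x z : V} (h : G.Adj x z) :
    lazyMeasure G p x z = (1 - p) / G.degree x := by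
  simp [lazyMeasure, h, h.ne']

theorem lazyMeasure_nonneg {p : ℝ} (h0 : 0 ≤ p) (h1 : p ≤ 1) (x z : V) :
    0 ≤ lazyMeasure G p x z := by
  unfold lazyMeasure
  split_ifs
  · exact h0
  · exact div_nonneg (by linarith) (Nat.cast_nonneg _)
  · exact le_rfl

theorem sum_mul_lazyMeasure (p : ℝ) (x : V) (φ : V → ℝ) :
    ∑ z ∈ G.neighborFinset x, φ z * lazyMeasure G p x z =
      (1 - p) / G.degree x * ∑ z ∈ G.neighborFinset x, φ z := by
  rw [mul_sum]
  refine sum_congr rfl fun z hz => ?_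
  rw [lazyMeasure_of_adj (by simpa using hz), mul_comm]

theorem sum_lazyMeasure (p : ℝ) {x : V} (hd : 0 < G.degree x) :
    ∑ z ∈ G.neighborFinset x, lazyMeasure G p x z = 1 - p := by
  have h := sum_mul_lazyMeasure (G := G) p x 1
  have hd' : (G.degree x : ℝ) ≠ 0 := by exact_mod_cast hd.ne'
  simp only [Pi.one_apply, one_mul, sum_const, nsmul_eq_mul, mul_one,
    G.card_neighborFinset_eq_degree] at h
  rw [h]
  field_simp

/-- Weak duality for non-lazy random walks. -/
theorem ollivierCurvature_zero_le {x y : V} (hx : 0 < G.degree x) (hy : 0 < G.degree y)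
    (φ ψ : V → ℝ)
    (hφψ : ∀ u v, G.Adj x u → G.Adj y v → φ u - ψ v ≤ G.dist u v) :
    ollivierCurvature G 0 x y ≤ 1 - ((∑ u ∈ G.neighborFinset x, φ u) / G.degree x -
      (∑ v ∈ G.neighborFinset y, ψ v) / G.degree y) := by
  have hsupp : ∀ w z : V, z ∉ G.neighborFinset w → lazyMeasure G 0 w z = 0 := by
    intro w z hz
    rw [SimpleGraph.mem_neighborFinset] at hz
    simp [lazyMeasure, hz]
  have h := sub_le_wasserstein (G := G) (hsupp x) (hsupp y)
    (lazyMeasure_nonneg le_rfl zero_le_one x) (lazyMeasure_nonneg le_rfl zero_le_one y)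
    (by rw [sum_lazyMeasure 0 hx, sub_zero]) (by rw [sum_lazyMeasure 0 hy, sub_zero]) φ ψ
    (fun u hu v hv => hφψ u v (by simpa using hu) (by simpa using hv))
  rw [sum_mul_lazyMeasure, sum_mul_lazyMeasure, sub_zero, one_div_mul_eq_div,
    one_div_mul_eq_div] at h
  unfold ollivierCurvature
  linarith

/-- Weak duality for lazy random walks. -/
theorem ollivierCurvature_le {x y : V} (hx : 0 < G.degree x) (hy : 0 < G.degree y)
    {p : ℝ} (h0 : 0 ≤ p) (h1 : p ≤ 1) (φ ψ : V → ℝ)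
    (hφψ : ∀ u v, (u = x ∨ G.Adj x u) → (v = y ∨ G.Adj y v) → φ u - ψ v ≤ G.dist u v) :
    ollivierCurvature G p x y ≤
      1 - ((φ x * p + (1 - p) / G.degree x * ∑ u ∈ G.neighborFinset x, φ u) -
        (ψ y * p + (1 - p) / G.degree y * ∑ v ∈ G.neighborFinset y, ψ v)) := by
  classical
  have hsupp : ∀ w z : V, z ∉ insert w (G.neighborFinset w) → lazyMeasure G p w z = 0 := by
    intro w z hz
    rw [mem_insert, SimpleGraph.mem_neighborFinset, not_or] at hz
    simp [lazyMeasure, hz]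
  have hmem : ∀ w : V, w ∉ G.neighborFinset w := fun w => by simp
  have hsum : ∀ w : V, 0 < G.degree w →
      ∑ z ∈ insert w (G.neighborFinset w), lazyMeasure G p w z = 1 := by
    intro w hw
    rw [sum_insert (hmem w), sum_lazyMeasure p hw, lazyMeasure_self]
    ring
  have h := sub_le_wasserstein (G := G) (hsupp x) (hsupp y)
    (lazyMeasure_nonneg h0 h1 x) (lazyMeasure_nonneg h0 h1 y) (hsum x hx) (hsum y hy) φ ψ
    (fun u hu v hv => hφψ u v (by simpa using hu) (by simpa using hv))
  rw [sum_insert (hmem x), sum_insert (hmem y), sum_mul_lazyMeasure, sum_mul_lazyMeasure,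
    lazyMeasure_self, lazyMeasure_self] at h
  unfold ollivierCurvature
  linarith

open Classical in
/-- If `κ₀(x, y) = 0`, then `y` is unmatched with at most one other neighbour of `x`. -/
theorem card_unmatched_le_one (hconn : G.Connected) {d : ℕ} (hd : 0 < d)
    (hreg : G.IsRegularOfDegree d) {x y : V} (htri : NotInTriangle G x) (hxy : G.Adj x y)
    (h : ollivierCurvature G 0 x y = 0) :
    #{u ∈ G.neighborFinset x | Unmatched G x y u} ≤ 1 := by
  rw [card_le_one]
  simp only [mem_filter, SimpleGraph.mem_neighborFinset]
  rintro a ⟨hxa, ha⟩ b ⟨hxb, hb⟩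
  by_contra hab
  have hfar : ∀ u v, G.Adj x u → Unmatched G x y u → G.Adj y v → v ≠ x →
      (2 : ℝ) ≤ G.dist u v := by
    intro u v hxu hu hyv hv
    refine two_le_dist hconn ?_ fun huv => hv (hu.2 v hyv huv)
    rintro rfl
    exact htri y u hxy hxu hyv
  have hdeg : ∀ w, 0 < G.degree w := fun w => by rwa [hreg w]
  -- The potentials 1 + 1_a + 1_b and 1_x give W₁ ≥ 1 + 2/d - 1/d > 1. The value 2 at a and b is
  -- allowed since both are at distance at least 2 from every neighbour of y except x.
  have hle := ollivierCurvature_zero_le (hdeg x) (hdeg y)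
    (fun u => 1 + (if u = a then 1 else 0) + (if u = b then 1 else 0))
    (fun v => if v = x then 1 else 0) (by
      intro u v hxu hyv
      have huv : u ≠ v := by
        rintro rfl
        exact htri y u hxy hxu hyv
      have h1 := one_le_dist hconn huv
      split_ifs with hua hub hv hv hub hv hv
      · exact absurd (hua.symm.trans hub) hab
      · exact absurd (hua.symm.trans hub) hab
      · linarith
      · linarith [hfar u v hxu (hua ▸ ha) hyv hv]
      · linarith
      · linarith [hfar u v hxu (hub ▸ hb) hyv hv]
      all_goals linarith)
  have hd' : (0 : ℝ) < d := by exact_mod_cast hd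
  rw [h, hreg x, hreg y] at hle
  simp only [sum_add_distrib, sum_const, nsmul_eq_mul, mul_one, sum_ite_eq',
    SimpleGraph.mem_neighborFinset, hxa, hxb, hxy.symm, if_true,
    G.card_neighborFinset_eq_degree, hreg x] at hle
  have : ((d : ℝ) + 1 + 1) / d - 1 / d = 1 + 1 / d := by field_simp; ring
  have hpos : 0 < 1 / (d : ℝ) := by positivity
  linarith

/-- If `κ_LLY(x, y) = 2/d`, then `y` is matched with every other neighbour of `x`. -/
theorem not_unmatched_of_hasLLYCurvature (hconn : G.Connected) {d : ℕ} (hd : 0 < d)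
    (hreg : G.IsRegularOfDegree d) {x y u : V} (htri : NotInTriangle G x) (hxy : G.Adj x y)
    (hxu : G.Adj x u) (h : HasLLYCurvature G x y (2 / d)) : ¬ Unmatched G x y u := by
  classical
  intro hu
  have hd' : (0 : ℝ) < d := by exact_mod_cast hd
  have hdeg : ∀ w, 0 < G.degree w := fun w => by rwa [hreg w]
  have hle : ∀ᶠ p : ℝ in 𝓝[<] 1, ollivierCurvature G p x y / (1 - p) ≤ 1 / d := by
    filter_upwards [Ioo_mem_nhdsLT (zero_lt_one' ℝ)] with p hp
    -- Laziness puts x and y in both supports. The value 1 of ψ at x and the term -1_y in φ make φ -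
    -- ψ vanish there; the result is W₁ ≥ 1 - (1 - p)/d.
    have hle := ollivierCurvature_le (hdeg x) (hdeg y) hp.1.le hp.2.le
      (fun w => 1 + (if w = u then 1 else 0) - (if w = y then 1 else 0))
      (fun v => if v = x then 1 else 0) (by
        intro w v hw hv
        have h0 : (0 : ℝ) ≤ G.dist w v := Nat.cast_nonneg _
        by_cases hwu : w = u
        · subst hwu
          have hwx : w ≠ x := hxu.ne'
          by_cases hvx : v = x
          · subst hvx
            simpa [hu.1] using one_le_dist hconn hwx
          · have hwv : w ≠ v := by
              rintro rfl
              rcases hv with rfl | hv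
              · exact hu.1 rfl
              · exact htri y w hxy hxu hv
            have hadj : ¬ G.Adj w v := by
              intro hwv'
              rcases hv with rfl | hv
              · exact htri w v hxu hxy hwv'
              · exact hvx (hu.2 v hv hwv')
            have := two_le_dist hconn hwv hadj
            simp only [if_true, if_neg hu.1, if_neg hvx]
            linarith
        · by_cases hwy : w = y
          · by_cases hvx : v = x
            · simp [hwy, hvx, Ne.symm hu.1]
              linarith
            · simp [hwy, hvx, Ne.symm hu.1]
          · by_cases hvx : v = x
            · simp [hwu, hwy, hvx]
            · have hwv : w ≠ v := by
                rintro rfl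
                rcases hv with rfl | hv
                · exact hwy rfl
                · rcases hw with rfl | hw
                  · exact hvx rfl
                  · exact htri y w hxy hw hv
              simpa [hwu, hwy, hvx] using one_le_dist hconn hwv)
    rw [hreg x, hreg y] at hle
    simp only [sum_add_distrib, sum_sub_distrib, sum_const, nsmul_eq_mul, mul_one, sum_ite_eq',
      SimpleGraph.mem_neighborFinset, hxu, hxy, hxy.symm, if_true, hxu.ne, hxy.ne, if_false,
      G.card_neighborFinset_eq_degree, hreg x, hxy.ne'] at hle
    have hp' : 0 < 1 - p := by linarith [hp.2]
    rw [div_le_iff₀ hp']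
    have : (1 - p) / d * ((d : ℝ) + 1 - 1) = 1 - p := by field_simp; ring
    have h2 : 1 / (d : ℝ) * (1 - p) = (1 - p) / d := by ring
    rw [this] at hle
    linarith
  have hlim := le_of_tendsto h hle
  rw [div_le_div_iff_of_pos_right hd'] at hlim
  norm_num at hlim

end Ollivier

end GraphCurvature

open GraphCurvature in
theorem theorem1p2 {V : Type*} (G : SimpleGraph V) [G.LocallyFinite] (hconn : G.Connected)
    (d : ℕ) (hd : 0 < d) (hreg : G.IsRegularOfDegree d)
    (x : V) (htri : GraphCurvature.NotInTriangle G x)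
    (hin : ∀ z ∈ GraphCurvature.sphere G x 2, GraphCurvature.inDegree G x z ≤ 2) :
    ((∀ y ∈ GraphCurvature.sphere G x 1, GraphCurvature.ollivierCurvature G 0 x y = 0) →
      ∃ K : ℝ, GraphCurvature.HasBECurvatureInfty G x K ∧ 0 ≤ K) ∧
    ((∀ y ∈ GraphCurvature.sphere G x 1,
        GraphCurvature.HasLLYCurvature G x y (2 / (d : ℝ))) →
      GraphCurvature.HasBECurvatureInfty G x 2) := by
  classical
  refine ⟨fun h => ?_, fun h => ?_⟩
  · refine exists_hasBECurvatureInfty hd hreg htri fun f => ?_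
    have hcd := mul_gam_le_gamTwo hreg htri hin (k := 1) (fun y hy => ?_) f
    · simpa using hcd
    · rw [SimpleGraph.mem_neighborFinset] at hy
      convert card_unmatched_le_one hconn hd hreg htri hy
        (h y (SimpleGraph.dist_eq_one_iff_adj.2 hy))
  · refine hasBECurvatureInfty_two hd hreg htri fun f => ?_
    have hcd := mul_gam_le_gamTwo hreg htri hin (k := 0) (fun y hy => ?_) f
    · simpa using hcd
    · rw [SimpleGraph.mem_neighborFinset] at hy
      rw [Nat.le_zero, Finset.card_eq_zero, Finset.filter_eq_empty_iff]
      intro u hu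
      exact not_unmatched_of_hasLLYCurvature hconn hd hreg htri hy (by simpa using hu)
        (h y (SimpleGraph.dist_eq_one_iff_adj.2 hy))
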